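/- Let $d\in\mathbb N$, $1\le d\le 4$, let $\Omega\subset\mathbb R^d$ be a bounded Lipschitz domain, $\alpha>0$, $u_d\in L^2(\Omega)$ and $f\in H^{-1}(\Omega)=H^1_0(\Omega)^*$. Let $j:H^1_0(\Omega)\to\mathbb R$ be convex, lower semicontinuous, bounded from below and Gâteaux differentiable with Lipschitz continuous derivative $j':H^1_0(\Omega)\to H^{-1}(\Omega)$. Let $S=(-\Delta)^{-1}:H^{-1}(\Omega)\to H^1_0(\Omega)$ be the solution operator of Poisson's equation and $$J(u)=j\big(S(u+f)\big)+\tfrac{\alpha}{2}\|u-u_d\|_{L^2(\Omega)}^2,\qquad J^*(w)=\sup_{u\in L^2(\Omega)}\Big(\int_\Omega u\,w\,dx-J(u)\Big)\qquad (u,w\in L^2(\Omega)).$$ Let $\|\varphi\|_\infty$ be the $L^\infty(\Omega)$-norm of the pointwise Euclidean norm of a vector field $\varphi$, and let $H_0(\operatorname{div};\Omega)$ be the closure of $C_c^\infty(\Omega;\mathbb R^d)$ in $H(\operatorname{div};\Omega)=\{\omega\in L^2(\Omega;\mathbb R^d):\operatorname{div}\omega\in L^2(\Omega)\}$ with respect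 to the norm $(\|\omega\|_{L^2}^2+\|\operatorname{div}\omega\|_{L^2}^2)^{1/2}$. Let $\mathcal H$ be a Hilbert space that contains $C_c^\infty(\Omega;\mathbb R^d)$ and is a proper subspace of $H_0(\operatorname{div};\Omega)$ with continuous embedding (e.g. $\mathcal H=H^1_0(\Omega;\mathbb R^d)$ for $d\ge2$), and let $a:\mathcal H\times\mathcal H\to\mathbb R$ be a symmetric, bounded and coercive bilinear form. Assume that $\{\varphi\in C_c^\infty(\Omega;\mathbb R^d):\|\varphi\|_\infty\le1\}$ is dense in $\{\varphi\in\mathcal H:\|\varphi\|_\infty\le1\}$ with respect to the norm of $\mathcal H$. For $\varepsilon>0$ and $u\in L^2(\Omega)$ set $$\mathrm{TV}(u)=\sup\Big\{\int_\Omega u\operatorname{div}\varphi\,dx:\ \varphi\in C_c^\infty(\Omega;\mathbb R^d),\ \|\varphi\|_\infty\le1\Big\},$$ $$\mathrm{TV}_\varepsilon(u)=\sup\Big\{-\tfrac{\varepsilon}{2}a[\varphi,\varphi]+\int_\Omega u\operatorname{div}\varphi\,dx:\ \varphi\in C_c^\infty(\Omega;\mathbb R^d),\ \|\varphi\|_\infty\le1\Big\}.$$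 Assume that the pre-dual problem $$\min\ J^*(\operatorname{div}\Phi)+\|\Phi\|_\infty\quad\text{s.t.}\quad \Phi\in H_0(\operatorname{div};\Omega)\cap L^\infty(\Omega;\mathbb R^d)$$ has at least one solution $\overline\Phi$ with $\overline\Phi\in\mathcal H$. Then the problem $\min J(u)$ s.t. $u\in BV(\Omega)\cap L^2(\Omega)$, $\mathrm{TV}(u)\le1$, has a unique solution $u^*$; for every $\varepsilon>0$ the problem $\min J(u)$ s.t. $u\in L^2(\Omega)$, $\mathrm{TV}_\varepsilon(u)\le1$, has a unique solution $u_\varepsilon$; and there is a constant $C>0$, independent of $\varepsilon$, such that for all $\varepsilon>0$ $$0\le J(u^*)-J(u_\varepsilon)\le C\,\varepsilon\qquad\text{and}\qquad \|u^*-u_\varepsilon\|_{L^2(\Omega)}\le C\,\sqrt{\varepsilon}.$$ -/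

import Mathlib

open MeasureTheory Set TopologicalSpace
open scoped ENNReal Distributions

namespace TVControl

/-- The Euclidean space `ℝ^d`. -/
abbrev Rd (d : ℕ) : Type := EuclideanSpace ℝ (Fin d)

/-- Bounded Lipschitz domains in `ℝ^d`: bounded, connected, (nonempty) open sets which, near every
boundary point, are the strict epigraph of a Lipschitz function of the variables orthogonal to some
direction `ν`. -/
structure IsBoundedLipschitzDomain {d : ℕ} (Ω : Opens (Rd d)) : Prop where
  connected : IsConnected (Ω : Set (Rd d))
  bounded : Bornology.IsBounded (Ω : Set (Rd d))
  boundary : ∀ x ∈ frontier (Ω : Set (Rd d)),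
    ∃ (ν : Rd d) (g : Rd d → ℝ) (K : NNReal) (r : ℝ),
      ‖ν‖ = 1 ∧ LipschitzWith K g ∧ 0 < r ∧
        ∀ y ∈ Metric.ball x r, (y ∈ Ω ↔ g (y - inner ℝ ν y • ν) < inner ℝ ν y)

section FunctionSpaces

variable {d : ℕ} (Ω : Opens (Rd d))

/-- Lebesgue measure on `Ω`. -/
noncomputable abbrev leb : Measure (Rd d) := volume.restrict (Ω : Set (Rd d))

/-- `L²(Ω)`. -/
abbrev L2 : Type := Lp ℝ 2 (leb Ω)

/-- `L²(Ω; ℝ^d)`. -/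
abbrev L2vec : Type := Lp (Rd d) 2 (leb Ω)

variable {Ω}

/-- The classical divergence `∑ᵢ ∂ᵢ φᵢ` of a vector field. -/
noncomputable def divergence (φ : Rd d → Rd d) (x : Rd d) : ℝ :=
  ∑ i, (fderiv ℝ φ x (EuclideanSpace.single i 1)) i

lemma divergence_eq (φ : Rd d → Rd d) (x : Rd d) : divergence φ x =
    (∑ i, (EuclideanSpace.proj i : Rd d →L[ℝ] ℝ).comp
      (ContinuousLinearMap.apply ℝ (Rd d) (EuclideanSpace.single i (1 : ℝ)))) (fderiv ℝ φ x) := by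
  simp [divergence]

lemma gradient_eq (φ : Rd d → ℝ) (x : Rd d) :
    gradient φ x = (InnerProductSpace.toDual ℝ (Rd d)).symm (fderiv ℝ φ x) := rfl

lemma memLp_test {F : Type*} [NormedAddCommGroup F] [NormedSpace ℝ F] (φ : 𝓓(Ω, F)) :
    MemLp (φ : Rd d → F) 2 (leb Ω) :=
  (φ.continuous.memLp_of_hasCompactSupport φ.hasCompactSupport).restrict _

lemma continuous_fderiv_test {F : Type*} [NormedAddCommGroup F] [NormedSpace ℝ F] (φ : 𝓓(Ω, F)) :
    Continuous (fderiv ℝ (φ : Rd d → F)) :=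
  φ.contDiff.continuous_fderiv (by simp)

lemma differentiable_test {F : Type*} [NormedAddCommGroup F] [NormedSpace ℝ F] (φ : 𝓓(Ω, F)) :
    Differentiable ℝ (φ : Rd d → F) :=
  φ.contDiff.differentiable (by simp)

lemma memLp_divergence (φ : 𝓓(Ω, Rd d)) : MemLp (divergence φ) 2 (leb Ω) := by
  refine (Continuous.memLp_of_hasCompactSupport ?_ ?_).restrict _
  · simp only [funext (divergence_eq (φ : Rd d → Rd d))]
    exact (ContinuousLinearMap.continuous _).comp (continuous_fderiv_test φ)
  · simp only [funext (divergence_eq (φ : Rd d → Rd d))]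
    exact (φ.hasCompactSupport.fderiv ℝ).comp_left (map_zero _)

lemma memLp_gradient (φ : 𝓓(Ω, ℝ)) : MemLp (gradient (φ : Rd d → ℝ)) 2 (leb Ω) := by
  refine (Continuous.memLp_of_hasCompactSupport ?_ ?_).restrict _
  · simp only [funext (gradient_eq (φ : Rd d → ℝ))]
    exact (LinearIsometryEquiv.continuous _).comp (continuous_fderiv_test φ)
  · simp only [funext (gradient_eq (φ : Rd d → ℝ))]
    exact (φ.hasCompactSupport.fderiv ℝ).comp_left (map_zero _)

/-! ### The spaces `H(div; Ω)` and `H₀(div; Ω)` -/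

variable (Ω) in
/-- `H(div; Ω)`: the pairs `(ω, g)` with `ω ∈ L²(Ω; ℝ^d)` and `g ∈ L²(Ω)` the distributional
divergence of `ω`. Since `g` is determined by `ω`, this is the usual space of vector fields; the
inner product inherited from `L²(Ω; ℝ^d) × L²(Ω)` is the usual one of `H(div; Ω)`. -/
noncomputable def Hdiv : Submodule ℝ (WithLp 2 (L2vec Ω × L2 Ω)) where
  carrier := {p | ∀ ψ : 𝓓(Ω, ℝ),
    inner ℝ p.fst (memLp_gradient ψ).toLp = - inner ℝ p.snd (memLp_test ψ).toLp}
  add_mem' := by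
    intro p q hp hq ψ
    simp only [mem_ofPred_eq] at hp hq
    simp only [WithLp.add_fst, WithLp.add_snd, inner_add_left, hp ψ, hq ψ]
    ring
  zero_mem' := by intro ψ; simp
  smul_mem' := by
    intro c p hp ψ
    simp only [mem_ofPred_eq] at hp
    simp only [WithLp.smul_fst, WithLp.smul_snd, real_inner_smul_left, hp ψ]
    ring

variable (Ω) in
/-- The map sending a test field `φ ∈ C_c^∞(Ω; ℝ^d)` to `(φ, div φ)`. -/
noncomputable def testPairDiv : 𝓓(Ω, Rd d) →ₗ[ℝ] WithLp 2 (L2vec Ω × L2 Ω) where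
  toFun φ := WithLp.toLp 2 ((memLp_test φ).toLp, (memLp_divergence φ).toLp)
  map_add' φ ψ := by
    have h : divergence (⇑(φ + ψ)) = divergence φ + divergence ψ := by
      funext x
      simp only [divergence_eq, Pi.add_apply, FunLike.coe_add]
      rw [fderiv_add (differentiable_test φ x) (differentiable_test ψ x), map_add]
    rw [← WithLp.toLp_add, Prod.mk_add_mk, ← MemLp.toLp_add, ← MemLp.toLp_add]
    simp only [h]
    rfl
  map_smul' c φ := by
    have h : divergence (⇑(c • φ)) = c • divergence φ := by
      funext x
      simp only [divergence_eq, Pi.smul_apply, FunLike.coe_smul]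
      rw [fderiv_const_smul (differentiable_test φ x), map_smul]
    rw [RingHom.id_apply, ← WithLp.toLp_smul, Prod.smul_mk, ← MemLp.toLp_const_smul,
      ← MemLp.toLp_const_smul]
    simp only [h]
    rfl

variable (Ω) in
/-- `H₀(div; Ω)`: the closure of `C_c^∞(Ω; ℝ^d)` with respect to the norm of `H(div; Ω)`. -/
noncomputable def H0divSubmodule : Submodule ℝ (WithLp 2 (L2vec Ω × L2 Ω)) :=
  (LinearMap.range (testPairDiv Ω)).topologicalClosure

variable (Ω) in
/-- `H₀(div; Ω)` as a Hilbert space. -/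
abbrev H0div : Type := H0divSubmodule Ω

/-- The vector field `ω ∈ L²(Ω; ℝ^d)` underlying an element of `H₀(div; Ω)`. -/
noncomputable def H0div.field (ω : H0div Ω) : L2vec Ω := ω.1.fst

/-- The divergence `div ω ∈ L²(Ω)` of an element of `H₀(div; Ω)`. -/
noncomputable def H0div.div (ω : H0div Ω) : L2 Ω := ω.1.snd

/-- A test field as an element of `H₀(div; Ω)`. -/
noncomputable def H0div.ofTest (φ : 𝓓(Ω, Rd d)) : H0div Ω :=
  ⟨testPairDiv Ω φ, Submodule.le_topologicalClosure _ (LinearMap.mem_range_self _ φ)⟩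

/-! ### The space `H₀¹(Ω)` and its dual -/

variable (Ω) in
/-- The map sending `φ ∈ C_c^∞(Ω)` to `(φ, ∇φ)`. -/
noncomputable def testPairGrad : 𝓓(Ω, ℝ) →ₗ[ℝ] WithLp 2 (L2 Ω × L2vec Ω) where
  toFun φ := WithLp.toLp 2 ((memLp_test φ).toLp, (memLp_gradient φ).toLp)
  map_add' φ ψ := by
    have h : gradient (⇑(φ + ψ)) = gradient φ + gradient ψ := by
      funext x
      simp only [gradient_eq, Pi.add_apply, FunLike.coe_add]
      rw [fderiv_add (differentiable_test φ x) (differentiable_test ψ x), map_add]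
    rw [← WithLp.toLp_add, Prod.mk_add_mk, ← MemLp.toLp_add, ← MemLp.toLp_add]
    simp only [h]
    rfl
  map_smul' c φ := by
    have h : gradient (⇑(c • φ)) = c • gradient φ := by
      funext x
      simp only [gradient_eq, Pi.smul_apply, FunLike.coe_smul]
      rw [fderiv_const_smul (differentiable_test φ x)]
      simp
    rw [RingHom.id_apply, ← WithLp.toLp_smul, Prod.smul_mk, ← MemLp.toLp_const_smul,
      ← MemLp.toLp_const_smul]
    simp only [h]
    rfl

variable (Ω) in
/-- `H₀¹(Ω)`: the closure of `C_c^∞(Ω)` with respect to the norm of `H¹(Ω)`; elements are the pairs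
consisting of a function and its weak gradient. -/
noncomputable def H10Submodule : Submodule ℝ (WithLp 2 (L2 Ω × L2vec Ω)) :=
  (LinearMap.range (testPairGrad Ω)).topologicalClosure

variable (Ω) in
/-- `H₀¹(Ω)` as a Hilbert space. -/
abbrev H10 : Type := H10Submodule Ω

/-- The function in `L²(Ω)` underlying an element of `H₀¹(Ω)`. -/
noncomputable def H10.fn (y : H10 Ω) : L2 Ω := y.1.fst

/-- The weak gradient of an element of `H₀¹(Ω)`. -/
noncomputable def H10.grad (y : H10 Ω) : L2vec Ω := y.1.snd

variable (Ω) in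
/-- `H⁻¹(Ω)`, the dual of `H₀¹(Ω)`. -/
abbrev Hm1 : Type := StrongDual ℝ (H10 Ω)

/-- The (continuous linear) embedding of `H₀¹(Ω)` into `L²(Ω)`, `y ↦ y`. -/
noncomputable def H10.fnL : H10 Ω →L[ℝ] L2 Ω :=
  (WithLp.fstL 2 ℝ (L2 Ω) (L2vec Ω)).comp (H10Submodule Ω).subtypeL

/-- The gradient as a continuous linear map on `H₀¹(Ω)`. -/
noncomputable def H10.gradL : H10 Ω →L[ℝ] L2vec Ω :=
  (WithLp.sndL 2 ℝ (L2 Ω) (L2vec Ω)).comp (H10Submodule Ω).subtypeL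

/-- The embedding `L²(Ω) ↪ H⁻¹(Ω)`, `u ↦ (v ↦ ∫_Ω u v)`. -/
noncomputable def L2.toHm1 (u : L2 Ω) : Hm1 Ω := (innerSL ℝ u).comp H10.fnL

/-- `y ∈ H₀¹(Ω)` solves `-Δ y = g` in `H⁻¹(Ω)`. -/
def IsPoissonSolution (g : Hm1 Ω) (y : H10 Ω) : Prop :=
  ∀ v : H10 Ω, inner ℝ y.grad v.grad = g v

/-- The solution operator `S = (-Δ)⁻¹ : H⁻¹(Ω) → H₀¹(Ω)`. On a bounded domain in dimension `d ≥ 1`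
this is the unique solution, see `isPoissonSolution_iff` below. -/
noncomputable def poisson (g : Hm1 Ω) : H10 Ω := Classical.epsilon (IsPoissonSolution g)

/-! ### Unique solvability of the Poisson equation, consistency of the definitions -/

lemma restrict_integral_eq {f : Rd d → ℝ} (hf : ∀ x ∉ (Ω : Set (Rd d)), f x = 0) :
    ∫ x in (Ω : Set (Rd d)), f x = ∫ x, f x :=
  setIntegral_eq_integral_of_forall_compl_eq_zero hf

lemma test_zero_outside {F : Type*} [NormedAddCommGroup F] [NormedSpace ℝ F] (φ : 𝓓(Ω, F))
    {x : Rd d} (hx : x ∉ (Ω : Set (Rd d))) : φ x = 0 :=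
  image_eq_zero_of_notMem_tsupport fun h => hx (φ.tsupport_subset h)

lemma fderiv_test_zero_outside {F : Type*} [NormedAddCommGroup F] [NormedSpace ℝ F] (φ : 𝓓(Ω, F))
    {x : Rd d} (hx : x ∉ (Ω : Set (Rd d))) : fderiv ℝ (φ : Rd d → F) x = 0 :=
  fderiv_of_notMem_tsupport (𝕜 := ℝ) fun h => hx (φ.tsupport_subset h)

lemma inner_gradient (ψ : Rd d → ℝ) (v x : Rd d) :
    inner ℝ v (gradient ψ x) = fderiv ℝ ψ x v := by
  rw [gradient_eq, real_inner_comm, InnerProductSpace.toDual_symm_apply]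

lemma testPairDiv_mem_Hdiv (φ : 𝓓(Ω, Rd d)) : testPairDiv Ω φ ∈ Hdiv Ω := by
  intro ψ
  have h1 : inner ℝ (testPairDiv Ω φ).fst (memLp_gradient ψ).toLp
      = ∫ x in (Ω : Set (Rd d)), inner ℝ (φ x) (gradient ψ x) := by
    rw [L2.inner_def]
    refine integral_congr_ae ?_
    filter_upwards [(memLp_test φ).coeFn_toLp, (memLp_gradient ψ).coeFn_toLp] with x hx hy
    exact congrArg₂ (inner ℝ) hx hy
  have h2 : inner ℝ (testPairDiv Ω φ).snd (memLp_test ψ).toLp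
      = ∫ x in (Ω : Set (Rd d)), divergence φ x * ψ x := by
    rw [L2.inner_def]
    refine integral_congr_ae ?_
    filter_upwards [(memLp_divergence φ).coeFn_toLp, (memLp_test ψ).coeFn_toLp] with x hx hy
    refine (congrArg₂ (inner ℝ) hx hy).trans ?_
    simp [mul_comm]
  rw [h1, h2, restrict_integral_eq (fun x hx => by simp [test_zero_outside φ hx]),
    restrict_integral_eq (fun x hx => by simp [test_zero_outside ψ hx])]
  have hcoord : ∀ i x, HasFDerivAt (fun x => φ x i)
      ((EuclideanSpace.proj i : Rd d →L[ℝ] ℝ).comp (fderiv ℝ φ x)) x := fun i x =>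
    (EuclideanSpace.proj i : Rd d →L[ℝ] ℝ).hasFDerivAt.comp x (differentiable_test φ x).hasFDerivAt
  have hci : ∀ i, HasCompactSupport (fun x => φ x i) := fun i =>
    φ.hasCompactSupport.comp_left (g := fun v : Rd d => v i) (by simp)
  have hcont : ∀ i, Continuous (fun x => φ x i) := fun i =>
    (EuclideanSpace.proj i : Rd d →L[ℝ] ℝ).continuous.comp φ.continuous
  have hψ' : ∀ i, Continuous (fun x => fderiv ℝ ψ x (EuclideanSpace.single i 1)) := fun i =>
    (continuous_fderiv_test ψ).clm_apply continuous_const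
  have hφ' : ∀ i, Continuous (fun x => fderiv ℝ φ x (EuclideanSpace.single i 1) i) := fun i =>
    (EuclideanSpace.proj i : Rd d →L[ℝ] ℝ).continuous.comp
      ((continuous_fderiv_test φ).clm_apply continuous_const)
  have hi1 : ∀ i, Integrable
      (fun x => φ x i * fderiv ℝ ψ x (EuclideanSpace.single i 1)) := fun i =>
    ((hcont i).mul (hψ' i)).integrable_of_hasCompactSupport ((hci i).mul_right)
  have hi2 : ∀ i, Integrable
      (fun x => fderiv ℝ φ x (EuclideanSpace.single i 1) i * ψ x) := fun i =>
    ((hφ' i).mul ψ.continuous).integrable_of_hasCompactSupport (ψ.hasCompactSupport.mul_left)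
  have hL : ∀ x, inner ℝ (φ x) (gradient ψ x)
      = ∑ i, φ x i * fderiv ℝ ψ x (EuclideanSpace.single i 1) := by
    intro x
    rw [PiLp.inner_apply]
    refine Finset.sum_congr rfl fun i _ => ?_
    rw [← inner_gradient, EuclideanSpace.inner_single_left]
    simp [mul_comm]
  have hR : ∀ x, divergence φ x * ψ x
      = ∑ i, fderiv ℝ φ x (EuclideanSpace.single i 1) i * ψ x := by
    intro x
    rw [divergence, Finset.sum_mul]
  simp_rw [hL, hR]
  rw [integral_finsetSum _ fun i _ => hi1 i, integral_finsetSum _ fun i _ => hi2 i,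
    ← Finset.sum_neg_distrib]
  refine Finset.sum_congr rfl fun i _ => ?_
  have key := integral_mul_fderiv_eq_neg_fderiv_mul_of_integrable (μ := (volume : Measure (Rd d)))
    (f := fun x => φ x i) (g := ψ) (v := EuclideanSpace.single i 1)
    (by
      refine (hi2 i).congr (ae_of_all _ fun x => ?_)
      simp [(hcoord i x).fderiv])
    (hi1 i)
    (((hcont i).mul ψ.continuous).integrable_of_hasCompactSupport ((hci i).mul_right))
    (fun x _ => (hcoord i x).differentiableAt) (fun x _ => differentiable_test ψ x)
  rw [key]
  congr 1
  refine integral_congr_ae (ae_of_all _ fun x => ?_)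
  simp [(hcoord i x).fderiv]

/-- `H₀(div; Ω) ⊆ H(div; Ω)`; in particular `H0div.div` is the distributional divergence of
`H0div.field`. -/
lemma H0divSubmodule_le_Hdiv : H0divSubmodule Ω ≤ Hdiv Ω := by
  refine Submodule.topologicalClosure_minimal _ ?_ ?_
  · rintro _ ⟨φ, rfl⟩
    exact testPairDiv_mem_Hdiv φ
  · have : ((Hdiv Ω : Submodule ℝ _) : Set (WithLp 2 (L2vec Ω × L2 Ω))) = ⋂ ψ : 𝓓(Ω, ℝ),
        {p | inner ℝ p.fst (memLp_gradient ψ).toLp = - inner ℝ p.snd (memLp_test ψ).toLp} := by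
      ext p
      simp [Hdiv]
    rw [this]
    refine isClosed_iInter fun ψ => isClosed_eq ?_ ?_
    · exact (WithLp.continuous_fst 2 _ _).inner continuous_const
    · exact ((WithLp.continuous_snd 2 _ _).inner continuous_const).neg

/-- Poincaré's inequality for test functions. -/
lemma poincare_test (hd : 1 ≤ d) {R : ℝ} (hR0 : 0 ≤ R)
    (hR : ∀ x ∈ (Ω : Set (Rd d)), ‖x‖ ≤ R) (φ : 𝓓(Ω, ℝ)) :
    ‖(testPairGrad Ω φ).fst‖ ≤ 2 * R * ‖(testPairGrad Ω φ).snd‖ := by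
  obtain ⟨i⟩ : Nonempty (Fin d) := ⟨⟨0, hd⟩⟩
  set e : Rd d := EuclideanSpace.single i 1 with he
  have hen : ‖e‖ = 1 := by simp [he]
  have h1 : ‖(testPairGrad Ω φ).fst‖ ^ 2 = ∫ x, φ x * φ x := by
    rw [← real_inner_self_eq_norm_sq, L2.inner_def,
      ← restrict_integral_eq (Ω := Ω) (fun x hx => by simp [test_zero_outside φ hx])]
    refine integral_congr_ae ?_
    filter_upwards [(memLp_test φ).coeFn_toLp] with x hx
    exact (congrArg₂ (inner ℝ) hx hx).trans (by simp [sq])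
  have h2 : ‖(testPairGrad Ω φ).snd‖ ^ 2 = ∫ x, ‖fderiv ℝ φ x‖ ^ 2 := by
    rw [← real_inner_self_eq_norm_sq, L2.inner_def,
      ← restrict_integral_eq (Ω := Ω) (fun x hx => by simp [fderiv_test_zero_outside φ hx])]
    refine integral_congr_ae ?_
    filter_upwards [(memLp_gradient φ).coeFn_toLp] with x hx
    refine (congrArg₂ (inner ℝ) hx hx).trans ?_
    rw [real_inner_self_eq_norm_sq, gradient_eq, LinearIsometryEquiv.norm_map]
  have hD : ∀ x, HasFDerivAt (fun x => φ x * φ x) (φ x • fderiv ℝ φ x + φ x • fderiv ℝ φ x) x :=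
    fun x => (differentiable_test φ x).hasFDerivAt.mul (differentiable_test φ x).hasFDerivAt
  have hφe : Continuous (fun x => fderiv ℝ φ x e) :=
    (continuous_fderiv_test φ).clm_apply continuous_const
  have hpe : Continuous (fun x : Rd d => x i) := (EuclideanSpace.proj i : Rd d →L[ℝ] ℝ).continuous
  have hpD : ∀ x : Rd d, HasFDerivAt (fun x : Rd d => x i) (EuclideanSpace.proj i : Rd d →L[ℝ] ℝ) x :=
    fun x => (EuclideanSpace.proj i : Rd d →L[ℝ] ℝ).hasFDerivAt
  have key := integral_mul_fderiv_eq_neg_fderiv_mul_of_integrable (μ := (volume : Measure (Rd d)))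
    (f := fun x => φ x * φ x) (g := fun x : Rd d => x i) (v := e)
    (by
      simp only [fun x => (hD x).fderiv]
      refine Continuous.integrable_of_hasCompactSupport ?_ ?_
      · simp only [add_apply, smul_apply, smul_eq_mul]
        fun_prop
      · refine HasCompactSupport.mul_right ?_
        refine φ.hasCompactSupport.mono fun x hx => ?_
        contrapose! hx
        simp only [Function.mem_support, not_not] at hx
        simp [hx])
    (by
      simp only [fun x => (hpD x).fderiv]
      refine Continuous.integrable_of_hasCompactSupport ?_ ?_
      · fun_prop
      · exact (φ.hasCompactSupport.mul_right).mul_right)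
    (by
      refine Continuous.integrable_of_hasCompactSupport ?_ ?_
      · fun_prop
      · exact (φ.hasCompactSupport.mul_right).mul_right)
    (fun x _ => (hD x).differentiableAt) (fun x _ => (hpD x).differentiableAt)
  have hiφ : Integrable (fun x => φ x * φ x) :=
    (φ.continuous.mul φ.continuous).integrable_of_hasCompactSupport φ.hasCompactSupport.mul_right
  have hid : Integrable (fun x => ‖fderiv ℝ φ x‖ ^ 2) := by
    refine Continuous.integrable_of_hasCompactSupport
      ((continuous_fderiv_test φ).norm.pow 2) ?_
    exact (φ.hasCompactSupport.fderiv ℝ).comp_left (g := fun T => ‖T‖ ^ 2) (by simp)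
  have h3 : ∫ x, φ x * φ x
      = - ∫ x, (2 * φ x * fderiv ℝ φ x e) * x i := by
    have hl : ∫ x, φ x * φ x = ∫ x, φ x * φ x * fderiv ℝ (fun x : Rd d => x i) x e := by
      refine integral_congr_ae (ae_of_all _ fun x => ?_)
      simp [(hpD x).fderiv, he]
    rw [hl, key]
    congr 1
    refine integral_congr_ae (ae_of_all _ fun x => ?_)
    simp only [(hD x).fderiv, add_apply, smul_apply, smul_eq_mul]
    ring
  have h4 : - ∫ x, (2 * φ x * fderiv ℝ φ x e) * x i
      ≤ ∫ x, ((1 / 2) * (φ x * φ x) + 2 * R ^ 2 * ‖fderiv ℝ φ x‖ ^ 2) := by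
    rw [← integral_neg]
    refine integral_mono ?_ ((hiφ.const_mul _).add (hid.const_mul _)) fun x => ?_
    · refine Continuous.integrable_of_hasCompactSupport (by fun_prop) ?_
      have hs : HasCompactSupport (fun x => 2 * φ x * fderiv ℝ φ x e * x i) :=
        HasCompactSupport.mul_right (HasCompactSupport.mul_right φ.hasCompactSupport.mul_left)
      exact hs.comp_left (g := fun t => -t) (by simp)
    · have hA : (fderiv ℝ φ x e * x i) ^ 2 ≤ R ^ 2 * ‖fderiv ℝ φ x‖ ^ 2 := by
        by_cases hx : x ∈ (Ω : Set (Rd d))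
        · have e1 : |fderiv ℝ φ x e| ≤ ‖fderiv ℝ φ x‖ := by
            simpa [hen] using (fderiv ℝ φ x).le_opNorm e
          have e2 : |x i| ≤ R := (PiLp.norm_apply_le x i).trans (hR x hx)
          rw [← sq_abs, abs_mul, ← mul_pow, mul_comm R]
          gcongr
        · simp [fderiv_test_zero_outside φ hx]
      simp only
      nlinarith [sq_nonneg (φ x + 2 * (fderiv ℝ φ x e * x i))]
  have h5 : ∫ x, ((1 / 2) * (φ x * φ x) + 2 * R ^ 2 * ‖fderiv ℝ φ x‖ ^ 2)
      = (1 / 2) * (∫ x, φ x * φ x) + 2 * R ^ 2 * ∫ x, ‖fderiv ℝ φ x‖ ^ 2 := by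
    rw [integral_add (hiφ.const_mul _) (hid.const_mul _), integral_const_mul, integral_const_mul]
  have h6 : ‖(testPairGrad Ω φ).fst‖ ^ 2 ≤ (2 * R * ‖(testPairGrad Ω φ).snd‖) ^ 2 := by
    rw [mul_pow, h1, h2]
    nlinarith [h3, h4, h5]
  exact abs_le_of_sq_le_sq' h6 (by positivity) |>.2

/-- Poincaré's inequality in `H₀¹(Ω)`. -/
lemma poincare (hd : 1 ≤ d) {R : ℝ} (hR0 : 0 ≤ R)
    (hR : ∀ x ∈ (Ω : Set (Rd d)), ‖x‖ ≤ R) (y : H10 Ω) : ‖y.fn‖ ≤ 2 * R * ‖y.grad‖ := by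
  have hcl : IsClosed {p : WithLp 2 (L2 Ω × L2vec Ω) | ‖p.fst‖ ≤ 2 * R * ‖p.snd‖} :=
    isClosed_le (WithLp.continuous_fst 2 _ _).norm
      (continuous_const.mul (WithLp.continuous_snd 2 _ _).norm)
  have hsub : ((LinearMap.range (testPairGrad Ω) : Submodule ℝ _) : Set _) ⊆
      {p : WithLp 2 (L2 Ω × L2vec Ω) | ‖p.fst‖ ≤ 2 * R * ‖p.snd‖} := by
    rintro _ ⟨φ, rfl⟩
    exact poincare_test hd hR0 hR φ
  exact closure_minimal hsub hcl y.2

instance : CompleteSpace (H10 Ω) :=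
  (Submodule.isClosed_topologicalClosure _).completeSpace_coe

instance : CompleteSpace (H0div Ω) :=
  (Submodule.isClosed_topologicalClosure _).completeSpace_coe

/-- On bounded domains, `S g` is the unique weak solution of `-Δ y = g`. -/
theorem isPoissonSolution_iff (hd : 1 ≤ d) (hΩ : Bornology.IsBounded (Ω : Set (Rd d)))
    (g : Hm1 Ω) (y : H10 Ω) : IsPoissonSolution g y ↔ y = poisson g := by
  obtain ⟨R, hR0, hR⟩ := hΩ.exists_pos_norm_le
  set B : H10 Ω →L[ℝ] H10 Ω →L[ℝ] ℝ := (innerSL ℝ).bilinearComp H10.gradL H10.gradL with hB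
  have hBa : ∀ y v, B y v = inner ℝ y.grad v.grad := fun y v => rfl
  have hco : IsCoercive B := by
    refine ⟨((2 * R) ^ 2 + 1)⁻¹, by positivity, fun y => ?_⟩
    have h := poincare hd hR0.le hR y
    have hn : ‖y‖ * ‖y‖ = ‖y.fn‖ ^ 2 + ‖y.grad‖ ^ 2 := by
      rw [← sq]
      exact WithLp.prod_norm_sq_eq_of_L2 y.1
    rw [mul_assoc, hn, hBa, real_inner_self_eq_norm_sq, inv_mul_le_iff₀ (by positivity)]
    have := pow_le_pow_left₀ (norm_nonneg _) h 2
    rw [mul_pow] at this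
    linarith
  have hex : ∃ y, IsPoissonSolution g y := by
    refine ⟨hco.continuousLinearEquivOfBilin.symm ((InnerProductSpace.toDual ℝ _).symm g),
      fun v => ?_⟩
    rw [← hBa, ← hco.continuousLinearEquivOfBilin_apply, ContinuousLinearEquiv.apply_symm_apply,
      InnerProductSpace.toDual_symm_apply]
  have huniq : ∀ y z, IsPoissonSolution g y → IsPoissonSolution g z → y = z := by
    intro y z hy hz
    have : ∀ {w}, IsPoissonSolution g w →
        hco.continuousLinearEquivOfBilin w = (InnerProductSpace.toDual ℝ _).symm g := by
      intro w hw
      refine ext_inner_right ℝ fun v => ?_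
      rw [hco.continuousLinearEquivOfBilin_apply, hBa, hw v, InnerProductSpace.toDual_symm_apply]
    exact hco.continuousLinearEquivOfBilin.injective ((this hy).trans (this hz).symm)
  have hsol : IsPoissonSolution g (poisson g) := Classical.epsilon_spec hex
  exact ⟨fun h => huniq _ _ h hsol, fun h => h ▸ hsol⟩

/-! ### The total variation and its dual regularization -/

variable (Ω) in
/-- The total variation
`TV(u) = sup { ∫_Ω u div φ : φ ∈ C_c^∞(Ω; ℝ^d), ‖φ‖_∞ ≤ 1 } ∈ [0, ∞]` of `u ∈ L¹(Ω)`. -/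
noncomputable def TV (u : Rd d → ℝ) : EReal :=
  ⨆ (φ : 𝓓(Ω, Rd d)) (_ : eLpNorm φ ∞ (leb Ω) ≤ 1),
    ((∫ x, u x * divergence φ x ∂(leb Ω) : ℝ) : EReal)

variable (Ω) in
/-- `u ∈ BV(Ω)`. -/
def MemBV (u : Rd d → ℝ) : Prop := Integrable u (leb Ω) ∧ TV Ω u < ⊤

section Regularization

variable {H : Type*} [NormedAddCommGroup H] [InnerProductSpace ℝ H]
  (ι : H →L[ℝ] H0div Ω) (a : H →L[ℝ] H →L[ℝ] ℝ)

/-- The elements `φ` of `H` (a space embedded into `H₀(div; Ω)` by `ι`) with `‖φ‖_∞ ≤ 1`. -/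
def unitBall : Set H := {h | eLpNorm (ι h).field ∞ (leb Ω) ≤ 1}

/-- The elements `φ` of `H` with `φ ∈ C_c^∞(Ω; ℝ^d)` and `‖φ‖_∞ ≤ 1`. -/
def testUnitBall : Set H :=
  {h | ∃ φ : 𝓓(Ω, Rd d), ι h = H0div.ofTest φ ∧ eLpNorm φ ∞ (leb Ω) ≤ 1}

/-- `F_ε(u, φ) = -(ε/2) a[φ, φ] + ∫_Ω u div φ`. -/
noncomputable def regFunctional (ε : ℝ) (u : Rd d → ℝ) (h : H) : ℝ :=
  -(ε / 2) * a h h + ∫ x, u x * (ι h).div x ∂(leb Ω)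

/-- The dual regularization
`TV_ε(u) = sup { F_ε(u, φ) : φ ∈ C_c^∞(Ω; ℝ^d), ‖φ‖_∞ ≤ 1 }` of the total variation. -/
noncomputable def regTV (ε : ℝ) (u : Rd d → ℝ) : EReal :=
  ⨆ h ∈ testUnitBall ι, (regFunctional ι a ε u h : EReal)

end Regularization

/-! ### The optimal control problems and the pre-dual problem -/

/-- The reduced objective `J(u) = j(S(u + f)) + (α/2) ‖u - u_d‖²_{L²(Ω)}`. -/
noncomputable def objective (j : H10 Ω → ℝ) (α : ℝ) (ud : L2 Ω) (f : Hm1 Ω) (u : L2 Ω) : ℝ :=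
  j (poisson (L2.toHm1 u + f)) + α / 2 * ‖u - ud‖ ^ 2

/-- `u` is a global solution of `min J(v)` subject to `v ∈ A`. -/
def IsSolution {X β : Type*} [Preorder β] (J : X → β) (A : Set X) (u : X) : Prop :=
  u ∈ A ∧ IsMinOn J A u

variable (Ω) in
/-- The feasible set `{u ∈ BV(Ω) ∩ L²(Ω) : TV(u) ≤ 1}` of the unregularized problem. -/
def feasible : Set (L2 Ω) := {u | MemBV Ω u ∧ TV Ω u ≤ 1}

/-- The feasible set `{u ∈ L²(Ω) : TV_ε(u) ≤ 1}` of the regularized problem. -/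
def regFeasible {H : Type*} [NormedAddCommGroup H] [InnerProductSpace ℝ H]
    (ι : H →L[ℝ] H0div Ω) (a : H →L[ℝ] H →L[ℝ] ℝ) (ε : ℝ) : Set (L2 Ω) :=
  {u | regTV ι a ε u ≤ 1}

/-- The Fenchel conjugate `J*(w) = sup_{u ∈ L²(Ω)} (u, w)_{L²(Ω)} - J(u)`. -/
noncomputable def conjugate (J : L2 Ω → ℝ) (w : L2 Ω) : EReal :=
  ⨆ u : L2 Ω, ((inner ℝ u w - J u : ℝ) : EReal)

/-- The objective `Φ ↦ J*(div Φ) + ‖Φ‖_∞` of the pre-dual problem. -/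
noncomputable def predualObjective (J : L2 Ω → ℝ) (Φ : H0div Ω) : EReal :=
  conjugate J Φ.div + (eLpNorm Φ.field ∞ (leb Ω) : EReal)

variable (Ω) in
/-- `H₀(div; Ω) ∩ L^∞(Ω; ℝ^d)`. -/
def boundedFields : Set (H0div Ω) := {Φ | eLpNorm Φ.field ∞ (leb Ω) < ∞}

/-- `j` is Gâteaux differentiable with Lipschitz continuous derivative
`j' : H₀¹(Ω) → H⁻¹(Ω)`. -/
def IsLSmooth (j : H10 Ω → ℝ) : Prop :=
  ∃ (j' : H10 Ω → Hm1 Ω) (L : NNReal),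
    (∀ y v, HasLineDerivAt ℝ j (j' y v) y v) ∧ LipschitzWith L j'

end FunctionSpaces

end TVControl

open TVControl

/-! The tracking term makes `J` strongly convex, and both feasible sets are intersections of
half-spaces of `L²(Ω)` containing `0`. Minimizing sequences are therefore Cauchy, which gives
existence, and quadratic growth at a minimizer gives uniqueness
(`existsUnique_isSolution_of_midpoint`). Since `a[φ, φ] ≥ 0`, `TV_ε ≤ TV`, so the regularized
feasible set is the larger one and `J(u_ε) ≤ J(u*)`.

The upper bound on the gap comes from duality. Let `Φ` solve the pre-dual problem and put `t =
‖Φ‖_∞`. Strong duality gives `J*(div Φ) + t ≤ -J(u*)` (`predualObjective_le_of_isSolution`), hence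
`J(u*) - J(u_ε) ≤ -(u_ε, div Φ) - t` by bounding the supremum `J*` below at `u_ε`. As `Φ` lies in
the Hilbert space, density allows `-Φ/t` as a test field in `TV_ε(u_ε) ≤ 1`; multiplied by `t`, this
bounds the right-hand side by `ε a[Φ, Φ] / (2t)` (`neg_inner_div_sub_norm_le`). If `t = 0`, then
`div Φ = 0` and the gap vanishes. Quadratic growth at `u_ε` turns the bound on the gap into the `√ε`
rate.

Strong duality rests on the bipolar theorem (`exists_dual_le`): by first-order optimality, `-∇J(u*)`
is nearly a multiple `s w` of the divergence `w` of an admissible test field, and strong convexity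
absorbs the approximation error. -/

namespace TVControl

/-! ### Strongly convex minimization and duality in Hilbert space -/

section Abstract

/-- A lower semicontinuous, uniformly midpoint convex function which is bounded from below attains
its minimum on every nonempty, closed and convex set. -/
theorem exists_isSolution_of_midpoint {X : Type*} [NormedAddCommGroup X] [NormedSpace ℝ X]
    [CompleteSpace X] {J : X → ℝ} {c : ℝ} (hc : 0 < c)
    (hJ : ∀ u v, J (midpoint ℝ u v) ≤ (J u + J v) / 2 - c * ‖u - v‖ ^ 2)
    (hlsc : LowerSemicontinuous J) (hbdd : BddBelow (range J)) {K : Set X} (hK : IsClosed K)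
    (hconv : Convex ℝ K) (hne : K.Nonempty) : ∃ u, IsSolution J K u := by
  have hb : BddBelow (J '' K) := hbdd.mono (image_subset_range _ _)
  set m := sInf (J '' K) with hm
  have hle : ∀ v ∈ K, m ≤ J v := fun v hv => csInf_le hb (mem_image_of_mem _ hv)
  have hseq : ∀ n : ℕ, ∃ v ∈ K, J v < m + 1 / ((n : ℝ) + 1) := fun n => by
    obtain ⟨_, ⟨v, hv, rfl⟩, h⟩ := exists_lt_of_csInf_lt (hne.image J)
      (lt_add_of_pos_right m (Nat.one_div_pos_of_nat (n := n)))
    exact ⟨v, hv, h⟩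
  choose v hvK hv using hseq
  -- The midpoint stays in `K`, so its value is at least `m`: two nearly optimal points must be
  -- close.
  have hdist : ∀ u ∈ K, ∀ w ∈ K, c * ‖u - w‖ ^ 2 ≤ (J u + J w) / 2 - m := fun u hu w hw => by
    have h1 := hle _ (hconv.midpoint_mem hu hw)
    linarith [hJ u w]
  have hto : Filter.Tendsto (fun n : ℕ => 1 / ((n : ℝ) + 1)) Filter.atTop (nhds 0) :=
    tendsto_one_div_add_atTop_nhds_zero_nat
  have hcau : CauchySeq v := by
    refine Metric.cauchySeq_iff'.2 fun ε hε => ?_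
    obtain ⟨N, hN⟩ := (hto.eventually (gt_mem_nhds (show (0 : ℝ) < c * ε ^ 2 by positivity))).exists
    refine ⟨N, fun n hn => ?_⟩
    have h1 := hdist _ (hvK n) _ (hvK N)
    have h2 : 1 / ((n : ℝ) + 1) ≤ 1 / ((N : ℝ) + 1) := by gcongr
    rw [dist_eq_norm]
    have h3 : c * ‖v n - v N‖ ^ 2 < c * ε ^ 2 := by linarith [hv n, hv N]
    exact lt_of_pow_lt_pow_left₀ 2 hε.le (lt_of_mul_lt_mul_left h3 hc.le)
  obtain ⟨u, hu⟩ := cauchySeq_tendsto_of_complete hcau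
  have huK : u ∈ K := hK.mem_of_tendsto hu (Filter.Eventually.of_forall hvK)
  -- Lower semicontinuity is used at the level halfway between `y` and `J u`, leaving room for the
  -- error `1 / (n + 1)`.
  refine ⟨u, huK, fun w hw => le_trans (le_of_forall_lt fun y hy => ?_) (hle w hw)⟩
  have h1 : ∀ᶠ n in Filter.atTop, y + (J u - y) / 2 < J (v n) :=
    hu.eventually (hlsc u _ (by linarith))
  have h2 := hto.eventually (gt_mem_nhds (show (0 : ℝ) < (J u - y) / 2 by linarith))
  obtain ⟨n, hn1, hn2⟩ := (h1.and h2).exists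
  linarith [hv n]

/-- Quadratic growth at a minimizer of a uniformly midpoint convex function. -/
theorem IsSolution.quadratic_growth {X : Type*} [NormedAddCommGroup X] [NormedSpace ℝ X]
    {J : X → ℝ} {c : ℝ} (hJ : ∀ u v, J (midpoint ℝ u v) ≤ (J u + J v) / 2 - c * ‖u - v‖ ^ 2)
    {K : Set X} (hconv : Convex ℝ K) {u v : X} (hu : IsSolution J K u) (hv : v ∈ K) :
    2 * c * ‖v - u‖ ^ 2 ≤ J v - J u := by
  have h1 : J u ≤ J (midpoint ℝ v u) := hu.2 (hconv.midpoint_mem hv hu.1)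
  linarith [hJ v u]

/-- Uniqueness is quadratic growth at one minimizer, evaluated at another one. -/
theorem existsUnique_isSolution_of_midpoint {X : Type*} [NormedAddCommGroup X] [NormedSpace ℝ X]
    [CompleteSpace X] {J : X → ℝ} {c : ℝ} (hc : 0 < c)
    (hJ : ∀ u v, J (midpoint ℝ u v) ≤ (J u + J v) / 2 - c * ‖u - v‖ ^ 2)
    (hlsc : LowerSemicontinuous J) (hbdd : BddBelow (range J)) {K : Set X} (hK : IsClosed K)
    (hconv : Convex ℝ K) (hne : K.Nonempty) : ∃! u, IsSolution J K u := by
  obtain ⟨u, hu⟩ := exists_isSolution_of_midpoint hc hJ hlsc hbdd hK hconv hne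
  refine ⟨u, hu, fun v hv => ?_⟩
  have h1 := hu.quadratic_growth hJ hconv hv.1
  have h2 : J v ≤ J u := hv.2 hu.1
  have h3 : ‖v - u‖ ^ 2 ≤ 0 := by
    by_contra! h
    nlinarith [mul_pos hc h]
  exact sub_eq_zero.1 (norm_eq_zero.1 (pow_eq_zero_iff two_ne_zero |>.1
    (le_antisymm h3 (sq_nonneg _))))

variable {X : Type*} [NormedAddCommGroup X] [InnerProductSpace ℝ X]

/-- The sum of a convex function and a multiple of the squared distance is uniformly midpoint
convex. -/
theorem midpoint_le_of_convexOn_add_sq {G : X → ℝ} (hG : ConvexOn ℝ univ G) (α : ℝ) (z u v : X) :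
    G (midpoint ℝ u v) + α / 2 * ‖midpoint ℝ u v - z‖ ^ 2
      ≤ ((G u + α / 2 * ‖u - z‖ ^ 2) + (G v + α / 2 * ‖v - z‖ ^ 2)) / 2
        - α / 8 * ‖u - v‖ ^ 2 := by
  have h1 : G ((1 / 2 : ℝ) • u + (1 / 2 : ℝ) • v) ≤ (1 / 2 : ℝ) • G u + (1 / 2 : ℝ) • G v :=
    hG.2 (mem_univ u) (mem_univ v) (by norm_num) (by norm_num) (by norm_num)
  have h2 : midpoint ℝ u v = (1 / 2 : ℝ) • u + (1 / 2 : ℝ) • v := by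
    rw [midpoint_eq_smul_add, smul_add]; norm_num
  have h3 : midpoint ℝ u v - z = (1 / 2 : ℝ) • ((u - z) + (v - z)) := by
    rw [h2]; module
  -- The parallelogram law makes the quadratic part an identity; this is the origin of the constant
  -- `α / 8`.
  have h4 := parallelogram_law_with_norm ℝ (u - z) (v - z)
  rw [sub_sub_sub_cancel_right] at h4
  have h5 : ‖midpoint ℝ u v - z‖ ^ 2 = 1 / 4 * ‖(u - z) + (v - z)‖ ^ 2 := by
    rw [h3, norm_smul, mul_pow]; norm_num
  rw [h5, h2]
  simp only [smul_eq_mul] at h1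
  have h6 : ‖(u - z) + (v - z)‖ ^ 2 = 2 * (‖u - z‖ ^ 2 + ‖v - z‖ ^ 2) - ‖u - v‖ ^ 2 := by
    linarith
  rw [h6]
  linarith

/-- Approximate strong duality: if `u₀` satisfies the first order optimality condition for the
minimization of `J` over the polar of `D`, then the dual problem
`inf J*(-s w) + s`, `s ≥ 0`, `w ∈ D`, has a value of at most `-J(u₀)`. -/
theorem exists_dual_le [CompleteSpace X] {J : X → ℝ} {c : ℝ} (hc : 0 < c) {u₀ p : X}
    (hJ : ∀ u, J u₀ + inner ℝ p (u - u₀) + c * ‖u - u₀‖ ^ 2 ≤ J u) {D : Set X} (hD : Convex ℝ D)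
    (hD0 : (0 : X) ∈ D)
    (hp : ∀ u, (∀ w ∈ D, inner ℝ u w ≤ 1) → 0 ≤ inner ℝ p (u - u₀)) {δ : ℝ} (hδ : 0 < δ) :
    ∃ s : ℝ, 0 ≤ s ∧ ∃ w ∈ D, ∀ u, inner ℝ u (-(s • w)) - J u + s ≤ -J u₀ + δ := by
  have hs0 : 0 ≤ - inner ℝ p u₀ := by simpa using hp 0 (by simp)
  -- Half of `δ` makes `s` positive and the separation below contradictory; the other half pays for
  -- replacing a closure point by a point of `D`.
  set s := - inner ℝ p u₀ + δ / 2 with hs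
  have hspos : 0 < s := by positivity
  -- Bipolar argument: a separating functional, normalized by its level `r`, lies in the polar of
  -- `D` and violates the optimality condition.
  have hmem : s⁻¹ • (-p) ∈ closure D := by
    by_contra hn
    obtain ⟨φ, r, hφ, hr⟩ := geometric_hahn_banach_closed_point hD.closure isClosed_closure hn
    have hr0 : 0 < r := by simpa using hφ 0 (subset_closure hD0)
    set z := r⁻¹ • (InnerProductSpace.toDual ℝ X).symm φ with hz
    have hzφ : ∀ w, inner ℝ z w = r⁻¹ * φ w := fun w => by
      rw [hz, real_inner_smul_left, InnerProductSpace.toDual_symm_apply]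
    have h1 := hp z fun w hw => by
      rw [hzφ, inv_mul_le_iff₀ hr0, mul_one]
      exact (hφ w (subset_closure hw)).le
    rw [inner_sub_right, real_inner_comm, hzφ] at h1
    rw [map_smul, map_neg, smul_eq_mul, lt_inv_mul_iff₀ hspos] at hr
    have h2 : s < r⁻¹ * -φ p := by rwa [lt_inv_mul_iff₀ hr0, mul_comm]
    linarith
  set M := ‖u₀‖ + 1 / (4 * c) with hM
  have hM0 : 0 ≤ M := by positivity
  -- Tolerance for the error `e` below. The cap `1` gives `κ ^ 2 ≤ κ`, so the total error is at most
  -- `κ * M`.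
  set κ := min 1 (δ / 2 / (M + 1)) with hκ
  have hκ0 : 0 < κ := by positivity
  have hκM : ‖u₀‖ * κ + κ ^ 2 / (4 * c) ≤ δ / 2 := by
    have h1 : κ ≤ 1 := min_le_left _ _
    have h2 : κ * (M + 1) ≤ δ / 2 := (le_div_iff₀ (by positivity)).1 (min_le_right _ _)
    have h3 : κ ^ 2 / (4 * c) ≤ κ * (1 / (4 * c)) := by
      rw [div_eq_mul_one_div]
      gcongr
      nlinarith
    nlinarith
  obtain ⟨w, hw, hwd⟩ := Metric.mem_closure_iff.1 hmem (κ / s) (by positivity)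
  refine ⟨s, hspos.le, w, hw, fun u => ?_⟩
  set e := -(s • w) - p with he
  have hek : ‖e‖ ≤ κ := by
    have h1 : e = s • (s⁻¹ • (-p) - w) := by
      rw [smul_sub, smul_inv_smul₀ hspos.ne', he]; module
    rw [h1, norm_smul, Real.norm_of_nonneg hspos.le, ← dist_eq_norm]
    exact ((lt_div_iff₀' hspos).1 hwd).le
  have h1 : -(s • w) = p + e := by rw [he]; module
  have h2 : inner ℝ u (p + e) = inner ℝ p (u - u₀) + inner ℝ p u₀ + inner ℝ u₀ e
      + inner ℝ (u - u₀) e := by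
    simp only [inner_add_right, inner_sub_right, inner_sub_left, real_inner_comm u p]
    ring
  have h3 : inner ℝ u₀ e ≤ ‖u₀‖ * κ :=
    (real_inner_le_norm _ _).trans (by gcongr)
  -- Young's inequality: the quadratic growth absorbs an error that is linear in the unbounded
  -- quantity `‖u - u₀‖`.
  have h4 : inner ℝ (u - u₀) e - c * ‖u - u₀‖ ^ 2 ≤ κ ^ 2 / (4 * c) := by
    have h5 : inner ℝ (u - u₀) e ≤ ‖u - u₀‖ * κ :=
      (real_inner_le_norm _ _).trans (by gcongr)
    rw [le_div_iff₀ (by positivity)]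
    nlinarith [sq_nonneg (2 * c * ‖u - u₀‖ - κ)]
  rw [h1, h2]
  linarith [hJ u]

/-- The subgradient inequality for a convex function with a line derivative. -/
theorem add_lineDeriv_le_of_convexOn {E : Type*} [AddCommGroup E] [Module ℝ E] {g : E → ℝ}
    (hg : ConvexOn ℝ univ g) {x v : E} {g' : ℝ} (h : HasLineDerivAt ℝ g g' x v) :
    g x + g' ≤ g (x + v) := by
  have h1 : Filter.Tendsto (fun t : ℝ => t⁻¹ • (g (x + t • v) - g x)) (nhdsWithin 0 (Ioi 0))
      (nhds g') := h.tendsto_slope_zero_right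
  have h2 : ∀ᶠ t : ℝ in nhdsWithin 0 (Ioi 0), t⁻¹ • (g (x + t • v) - g x) ≤ g (x + v) - g x := by
    filter_upwards [Ioo_mem_nhdsGT (zero_lt_one (α := ℝ))] with t ht
    have h3 : g ((1 - t) • x + t • (x + v)) ≤ (1 - t) • g x + t • g (x + v) :=
      hg.2 (mem_univ x) (mem_univ (x + v)) (by linarith [ht.2]) ht.1.le (by ring)
    rw [show (1 - t) • x + t • (x + v) = x + t • v by module] at h3
    rw [smul_eq_mul, inv_mul_le_iff₀ ht.1]
    simp only [smul_eq_mul] at h3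
    linarith
  linarith [le_of_tendsto h1 h2]

/-- The first order necessary optimality condition. -/
theorem IsSolution.lineDeriv_nonneg {E : Type*} [AddCommGroup E] [Module ℝ E] {g : E → ℝ}
    {K : Set E} (hK : Convex ℝ K) {x y : E} (hx : IsSolution g K x) (hy : y ∈ K) {g' : ℝ}
    (h : HasLineDerivAt ℝ g g' x (y - x)) : 0 ≤ g' := by
  have h1 : Filter.Tendsto (fun t : ℝ => t⁻¹ • (g (x + t • (y - x)) - g x))
      (nhdsWithin 0 (Ioi 0)) (nhds g') := h.tendsto_slope_zero_right
  refine ge_of_tendsto h1 ?_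
  filter_upwards [Ioo_mem_nhdsGT (zero_lt_one (α := ℝ))] with t ht
  have h2 : g x ≤ g (x + t • (y - x)) :=
    hx.2 (hK.add_smul_sub_mem hx.1 hy ⟨ht.1.le, ht.2.le⟩)
  rw [smul_eq_mul]
  exact mul_nonneg (inv_nonneg.2 ht.1.le) (sub_nonneg.2 h2)

/-- The squared distance has the expected line derivatives. -/
theorem hasLineDerivAt_sq_dist (α : ℝ) (z x v : X) :
    HasLineDerivAt ℝ (fun u => α / 2 * ‖u - z‖ ^ 2) (α * inner ℝ (x - z) v) x v := by
  have h1 : HasFDerivAt (fun u : X => ‖u - z‖ ^ 2) _ x :=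
    ((hasFDerivAt_id x).sub_const z).norm_sq
  have h2 := (h1.const_mul (α / 2)).hasLineDerivAt v
  convert h2 using 1
  simp [inner_sub_left]
  ring

end Abstract

/-! ### Continuity of the control-to-state map -/

variable {d : ℕ} {Ω : Opens (Rd d)}

/-- On bounded domains, the solution operator of the Poisson equation is linear and continuous. -/
theorem exists_clm_eq_poisson (hd : 1 ≤ d) (hΩ : Bornology.IsBounded (Ω : Set (Rd d))) :
    ∃ S : Hm1 Ω →L[ℝ] H10 Ω, ∀ g, S g = poisson g := by
  obtain ⟨R, hR0, hR⟩ := hΩ.exists_pos_norm_le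
  have hsol : ∀ g : Hm1 Ω, IsPoissonSolution g (poisson g) := fun g =>
    (isPoissonSolution_iff hd hΩ g _).2 rfl
  let T : Hm1 Ω →ₗ[ℝ] H10 Ω :=
    { toFun := poisson
      map_add' := fun g₁ g₂ => by
        -- Linearity follows from uniqueness: the sum of the solutions solves the equation for the
        -- sum.
        refine ((isPoissonSolution_iff hd hΩ _ _).1 fun v => ?_).symm
        have h : (poisson g₁ + poisson g₂).grad = (poisson g₁).grad + (poisson g₂).grad := rfl
        rw [h, inner_add_left, hsol g₁, hsol g₂]
        rfl
      map_smul' := fun c g => by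
        refine ((isPoissonSolution_iff hd hΩ _ _).1 fun v => ?_).symm
        have h : (c • poisson g).grad = c • (poisson g).grad := rfl
        rw [RingHom.id_apply, h, real_inner_smul_left, hsol g]
        rfl }
  have hT : ∀ g, ‖T g‖ ≤ ((2 * R) ^ 2 + 1) * ‖g‖ := ?_
  · exact ⟨⟨T, AddMonoidHomClass.continuous_of_bound T _ hT⟩, fun g => rfl⟩
  intro g
  change ‖poisson g‖ ≤ _
  have h1 := poincare hd hR0.le hR (poisson g)
  have hn : ‖poisson g‖ ^ 2 = ‖(poisson g).fn‖ ^ 2 + ‖(poisson g).grad‖ ^ 2 :=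
    WithLp.prod_norm_sq_eq_of_L2 (poisson g).1
  have h2 : ‖(poisson g).grad‖ ^ 2 ≤ ‖g‖ * ‖poisson g‖ := by
    rw [← real_inner_self_eq_norm_sq, hsol g]
    exact (le_abs_self _).trans (g.le_opNorm _)
  have h3 := pow_le_pow_left₀ (norm_nonneg _) h1 2
  rw [mul_pow] at h3
  -- Poincaré combined with the equation tested by its own solution; one factor `‖poisson g‖` is
  -- cancelled afterwards.
  have h4 : ‖poisson g‖ * ‖poisson g‖ ≤ (((2 * R) ^ 2 + 1) * ‖g‖) * ‖poisson g‖ := by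
    nlinarith [sq_nonneg (2 * R)]
  rcases (norm_nonneg (poisson g)).eq_or_lt with h | h
  · rw [← h]; positivity
  · exact le_of_mul_le_mul_right h4 h

/-- The embedding `L²(Ω) ↪ H⁻¹(Ω)` as a continuous linear map. -/
noncomputable def L2.toHm1L : L2 Ω →L[ℝ] Hm1 Ω :=
  { toFun := L2.toHm1
    map_add' := fun u v => by simp only [L2.toHm1, map_add, ContinuousLinearMap.add_comp]
    map_smul' := fun c u => by
      ext v
      exact real_inner_smul_left u (H10.fnL v) c
    cont := by unfold L2.toHm1; fun_prop }

theorem L2.toHm1L_apply (u : L2 Ω) : L2.toHm1L u = L2.toHm1 u := rfl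

/-- The control-to-state map is affine and continuous. -/
theorem exists_clm_add_eq_state (hd : 1 ≤ d) (hΩ : Bornology.IsBounded (Ω : Set (Rd d)))
    (f : Hm1 Ω) : ∃ (T : L2 Ω →L[ℝ] H10 Ω) (y : H10 Ω), ∀ u, poisson (L2.toHm1 u + f) = T u + y := by
  obtain ⟨S, hS⟩ := exists_clm_eq_poisson hd hΩ
  exact ⟨S.comp L2.toHm1L, S f, fun u => by
    rw [← hS, map_add, ContinuousLinearMap.comp_apply, L2.toHm1L_apply]⟩

/-! ### The feasible sets as polars -/

/-- The divergence as a continuous linear map on `H₀(div; Ω)`. -/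
noncomputable def H0div.divL : H0div Ω →L[ℝ] L2 Ω :=
  (WithLp.sndL 2 ℝ (L2vec Ω) (L2 Ω)).comp (H0divSubmodule Ω).subtypeL

theorem H0div.divL_apply (ω : H0div Ω) : H0div.divL ω = ω.div := rfl

theorem ofTest_div (φ : 𝓓(Ω, Rd d)) : (H0div.ofTest φ).div = (memLp_divergence φ).toLp := rfl

theorem ofTest_field (φ : 𝓓(Ω, Rd d)) : (H0div.ofTest φ).field = (memLp_test φ).toLp := rfl

theorem eLpNorm_ofTest_field (φ : 𝓓(Ω, Rd d)) :
    eLpNorm (H0div.ofTest φ).field ∞ (leb Ω) = eLpNorm φ ∞ (leb Ω) :=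
  eLpNorm_congr_ae (memLp_test φ).coeFn_toLp

theorem ofTest_add (φ ψ : 𝓓(Ω, Rd d)) :
    H0div.ofTest (φ + ψ) = H0div.ofTest φ + H0div.ofTest ψ :=
  Subtype.ext (map_add (testPairDiv Ω) φ ψ)

theorem ofTest_smul (c : ℝ) (φ : 𝓓(Ω, Rd d)) :
    H0div.ofTest (c • φ) = c • H0div.ofTest φ :=
  Subtype.ext (map_smul (testPairDiv Ω) c φ)

theorem eLpNorm_field_smul (c : ℝ) (ω : H0div Ω) :
    eLpNorm (c • ω).field ∞ (leb Ω) = ENNReal.ofReal |c| * eLpNorm ω.field ∞ (leb Ω) := by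
  have h : (c • ω).field = c • ω.field := rfl
  rw [h, eLpNorm_congr_ae (Lp.coeFn_smul c ω.field), eLpNorm_const_smul,
    ← Real.norm_eq_abs, ofReal_norm]

theorem integral_mul_eq_inner (u w : L2 Ω) : ∫ x, u x * w x ∂(leb Ω) = inner ℝ u w := by
  rw [L2.inner_def]
  refine integral_congr_ae (ae_of_all _ fun x => ?_)
  simp [mul_comm]

theorem integral_mul_divergence (u : L2 Ω) (φ : 𝓓(Ω, Rd d)) :
    ∫ x, u x * divergence φ x ∂(leb Ω) = inner ℝ u (H0div.ofTest φ).div := by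
  rw [← integral_mul_eq_inner]
  refine integral_congr_ae ?_
  filter_upwards [(memLp_divergence φ).coeFn_toLp] with x hx
  rw [ofTest_div, hx]

variable (Ω) in
/-- The divergences of the test fields `φ` with `‖φ‖_∞ ≤ 1`. -/
def testDivergences : Set (L2 Ω) :=
  {w | ∃ φ : 𝓓(Ω, Rd d), eLpNorm φ ∞ (leb Ω) ≤ 1 ∧ (H0div.ofTest φ).div = w}

theorem zero_mem_testDivergences : (0 : L2 Ω) ∈ testDivergences Ω := by
  refine ⟨0, by simp, ?_⟩
  have h := ofTest_smul (Ω := Ω) 0 0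
  rw [zero_smul, zero_smul] at h
  rw [h]
  rfl

/-- Convexity is what the separation argument in `exists_dual_le` needs. -/
theorem convex_testDivergences : Convex ℝ (testDivergences Ω) := by
  rintro _ ⟨φ, hφ, rfl⟩ _ ⟨ψ, hψ, rfl⟩ s t hs ht hst
  refine ⟨s • φ + t • ψ, ?_, ?_⟩
  · have h1 : ∀ (c : ℝ) (φ : 𝓓(Ω, Rd d)), 0 ≤ c → eLpNorm φ ∞ (leb Ω) ≤ 1 →
        eLpNorm (c • φ : 𝓓(Ω, Rd d)) ∞ (leb Ω) ≤ ENNReal.ofReal c := fun c φ hc hφ => by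
      rw [← eLpNorm_ofTest_field, ofTest_smul, eLpNorm_field_smul, eLpNorm_ofTest_field,
        abs_of_nonneg hc]
      exact mul_le_of_le_one_right' hφ
    calc eLpNorm (s • φ + t • ψ : 𝓓(Ω, Rd d)) ∞ (leb Ω)
        ≤ eLpNorm (s • φ : 𝓓(Ω, Rd d)) ∞ (leb Ω) + eLpNorm (t • ψ : 𝓓(Ω, Rd d)) ∞ (leb Ω) :=
          eLpNorm_add_le (memLp_test _).1 (memLp_test _).1 le_top
      _ ≤ ENNReal.ofReal s + ENNReal.ofReal t := add_le_add (h1 s φ hs hφ) (h1 t ψ ht hψ)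
      _ = 1 := by rw [← ENNReal.ofReal_add hs ht, hst, ENNReal.ofReal_one]
  · rw [ofTest_add, ofTest_smul, ofTest_smul]
    rfl

theorem TV_le_one_iff (u : L2 Ω) : TV Ω u ≤ 1 ↔ ∀ w ∈ testDivergences Ω, inner ℝ u w ≤ 1 := by
  have h : TV Ω u ≤ 1 ↔ ∀ φ : 𝓓(Ω, Rd d), eLpNorm φ ∞ (leb Ω) ≤ 1 →
      inner ℝ u (H0div.ofTest φ).div ≤ 1 := by
    rw [TV, iSup₂_le_iff]
    refine forall₂_congr fun φ _ => ?_
    rw [integral_mul_divergence, ← EReal.coe_one, EReal.coe_le_coe_iff]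
  rw [h]
  constructor
  · rintro h _ ⟨φ, hφ, rfl⟩
    exact h φ hφ
  · exact fun h φ hφ => h _ ⟨φ, hφ, rfl⟩

/-- Membership in `BV(Ω)` costs nothing here: `L²(Ω) ⊆ L¹(Ω)` on a bounded domain, and `TV ≤ 1` is
finite. -/
theorem mem_feasible_iff (hΩ : Bornology.IsBounded (Ω : Set (Rd d))) (u : L2 Ω) :
    u ∈ feasible Ω ↔ ∀ w ∈ testDivergences Ω, inner ℝ u w ≤ 1 := by
  rw [← TV_le_one_iff]
  refine ⟨fun h => h.2, fun h => ⟨⟨?_, h.trans_lt (EReal.coe_lt_top 1)⟩, h⟩⟩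
  have : IsFiniteMeasure (leb Ω) := ⟨by
    rw [Measure.restrict_apply_univ]; exact hΩ.measure_lt_top⟩
  exact (Lp.memLp u).integrable one_le_two

/-- The variable bounds `b i` accommodate the regularized constraint, whose right-hand side `1 + ε /
2 * a h h` depends on the test field. -/
theorem isClosed_polar {X ι : Type*} [NormedAddCommGroup X] [InnerProductSpace ℝ X]
    (w : ι → X) (b : ι → ℝ) (s : Set ι) : IsClosed {u : X | ∀ i ∈ s, inner ℝ u (w i) ≤ b i} := by
  simp only [ofPred_forall]
  exact isClosed_biInter fun i _ => isClosed_le (by fun_prop) (by fun_prop)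

theorem convex_polar {X ι : Type*} [NormedAddCommGroup X] [InnerProductSpace ℝ X]
    (w : ι → X) (b : ι → ℝ) (s : Set ι) : Convex ℝ {u : X | ∀ i ∈ s, inner ℝ u (w i) ≤ b i} := by
  intro u hu v hv p q hp hq hpq i hi
  rw [inner_add_left, real_inner_smul_left, real_inner_smul_left]
  have h1 := mul_le_mul_of_nonneg_left (hu i hi) hp
  have h2 := mul_le_mul_of_nonneg_left (hv i hi) hq
  calc _ ≤ p * b i + q * b i := add_le_add h1 h2
    _ = b i := by rw [← add_mul, hpq, one_mul]

/-! ### The regularized feasible set -/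

section Regularization

variable {H : Type*} [NormedAddCommGroup H] [InnerProductSpace ℝ H]
  {ι : H →L[ℝ] H0div Ω} {a : H →L[ℝ] H →L[ℝ] ℝ} {ε : ℝ}

theorem regFunctional_eq (u : L2 Ω) (h : H) :
    regFunctional ι a ε u h = -(ε / 2) * a h h + inner ℝ u (ι h).div := by
  rw [regFunctional, integral_mul_eq_inner]

theorem mem_regFeasible_iff (u : L2 Ω) : u ∈ regFeasible ι a ε ↔
    ∀ h ∈ testUnitBall ι, inner ℝ u (ι h).div ≤ 1 + ε / 2 * a h h := by
  change regTV ι a ε u ≤ 1 ↔ _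
  rw [regTV, iSup₂_le_iff]
  refine forall₂_congr fun h _ => ?_
  rw [regFunctional_eq, ← EReal.coe_one, EReal.coe_le_coe_iff]
  constructor <;> intro h <;> linarith

/-- The defining inequality of the regularized feasible set extends to the whole unit ball. -/
theorem inner_div_le_of_mem_regFeasible (h_dense : unitBall ι ⊆ closure (testUnitBall ι))
    {u : L2 Ω} (hu : u ∈ regFeasible ι a ε) {h : H} (hh : h ∈ unitBall ι) :
    inner ℝ u (ι h).div ≤ 1 + ε / 2 * a h h := by
  -- Both sides are continuous in the norm of `H`, so the inequality passes from test fields to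
  -- limits.
  have hcl : IsClosed {h : H | inner ℝ u (H0div.divL (ι h)) ≤ 1 + ε / 2 * a h h} :=
    isClosed_le (by fun_prop) (by fun_prop)
  exact closure_minimal ((mem_regFeasible_iff u).1 hu) hcl (h_dense hh)

/-- The penalty only lowers the supremum. This inclusion yields the lower bound of the gap and makes
`uStar` a competitor for `uε`. -/
theorem feasible_subset_regFeasible (hΩ : Bornology.IsBounded (Ω : Set (Rd d)))
    (ha : ∀ h, 0 ≤ a h h) (hε : 0 ≤ ε) : feasible Ω ⊆ regFeasible ι a ε := by
  intro u hu
  rw [mem_regFeasible_iff]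
  rintro h ⟨φ, hφ, hφ1⟩
  have h1 := (mem_feasible_iff hΩ u).1 hu _ ⟨φ, hφ1, rfl⟩
  rw [hφ]
  have := mul_nonneg (div_nonneg hε zero_le_two) (ha h)
  linarith

end Regularization

/-- A field in `H₀(div; Ω)` which vanishes almost everywhere has divergence zero. -/
theorem div_eq_zero_of_field_eq_zero {ω : H0div Ω} (h : ω.field = 0) : ω.div = 0 := by
  have hω := H0divSubmodule_le_Hdiv ω.2
  have h1 : ∀ᵐ x ∂volume, x ∈ (Ω : Set (Rd d)) → ω.div x = 0 := by
    -- Fundamental lemma of the calculus of variations: integrating `div ω` against a test function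
    -- gives minus the integral of `ω` against its gradient, which is zero.
    refine Ω.isOpen.ae_eq_zero_of_integral_contDiff_smul_eq_zero ?_ fun g hg hgc hgs => ?_
    · exact locallyIntegrableOn_of_locallyIntegrable_restrict
        ((Lp.memLp ω.div).locallyIntegrable one_le_two)
    · let ψ : 𝓓(Ω, ℝ) := ⟨g, hg, hgc, hgs⟩
      have h2 : inner ℝ ω.field (memLp_gradient ψ).toLp
        = - inner ℝ ω.div (memLp_test ψ).toLp := hω ψ
      rw [h, inner_zero_left, zero_eq_neg, ← integral_mul_eq_inner] at h2
      rw [← restrict_integral_eq (Ω := Ω) fun x hx => by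
        rw [show g x = 0 from test_zero_outside ψ hx, zero_smul], ← h2]
      refine integral_congr_ae ?_
      filter_upwards [(memLp_test ψ).coeFn_toLp] with x hx
      rw [hx, smul_eq_mul, mul_comm]
      rfl
  refine (Lp.eq_zero_iff_ae_eq_zero).2 ?_
  exact (ae_restrict_iff' Ω.isOpen.measurableSet).2 h1

/-! ### Convexity and differentiability of the reduced objective -/

section Objective

variable {j : H10 Ω → ℝ} {α : ℝ} {ud : L2 Ω} {f : Hm1 Ω}

/-- The state is affine in the control, so the first term stays convex and the tracking term
supplies the modulus `α / 8`. -/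
theorem objective_midpoint_le (hd : 1 ≤ d) (hΩ : Bornology.IsBounded (Ω : Set (Rd d)))
    (hj : ConvexOn ℝ univ j) (u v : L2 Ω) :
    objective j α ud f (midpoint ℝ u v)
      ≤ (objective j α ud f u + objective j α ud f v) / 2 - α / 8 * ‖u - v‖ ^ 2 := by
  obtain ⟨T, y, hT⟩ := exists_clm_add_eq_state hd hΩ f
  simp only [objective, hT]
  have hG : ConvexOn ℝ univ fun u => j (T u + y) :=
    (hj.translate_left y).comp_linearMap T.toLinearMap
  exact midpoint_le_of_convexOn_add_sq hG α ud u v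

theorem lowerSemicontinuous_objective (hd : 1 ≤ d) (hΩ : Bornology.IsBounded (Ω : Set (Rd d)))
    (hj : LowerSemicontinuous j) : LowerSemicontinuous (objective j α ud f) := by
  obtain ⟨T, y, hT⟩ := exists_clm_add_eq_state hd hΩ f
  have h : objective j α ud f = fun u => j (T u + y) + α / 2 * ‖u - ud‖ ^ 2 := by
    funext u
    rw [objective, hT]
  rw [h]
  exact (hj.comp (by fun_prop : Continuous fun u => T u + y)).add
    (by fun_prop : Continuous fun u : L2 Ω => α / 2 * ‖u - ud‖ ^ 2).lowerSemicontinuous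

theorem bddBelow_range_objective (hα : 0 ≤ α) (hj : BddBelow (range j)) :
    BddBelow (range (objective j α ud f)) := by
  obtain ⟨m, hm⟩ := hj
  refine ⟨m, ?_⟩
  rintro _ ⟨u, rfl⟩
  have h1 : m ≤ j (poisson (L2.toHm1 u + f)) := hm (mem_range_self _)
  have h2 : 0 ≤ α / 2 * ‖u - ud‖ ^ 2 := by positivity
  rw [objective]
  linarith

/-- The reduced objective has a gradient at every point, and grows quadratically around its
linearization. -/
theorem exists_gradient_objective (hd : 1 ≤ d) (hΩ : Bornology.IsBounded (Ω : Set (Rd d)))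
    (hj : ConvexOn ℝ univ j) (hj' : IsLSmooth j) (u₀ : L2 Ω) : ∃ p : L2 Ω,
      (∀ v, HasLineDerivAt ℝ (objective j α ud f) (inner ℝ p v) u₀ v) ∧
      ∀ u, objective j α ud f u₀ + inner ℝ p (u - u₀) + α / 2 * ‖u - u₀‖ ^ 2
        ≤ objective j α ud f u := by
  obtain ⟨T, y, hT⟩ := exists_clm_add_eq_state hd hΩ f
  obtain ⟨j', -, hj', -⟩ := hj'
  have h : objective j α ud f = fun u => j (T u + y) + α / 2 * ‖u - ud‖ ^ 2 := by
    funext u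
    rw [objective, hT]
  -- The derivative of `j` at the state, pulled back by `T` and represented in `L²(Ω)` by Riesz.
  set q := (InnerProductSpace.toDual ℝ (L2 Ω)).symm ((j' (T u₀ + y)).comp T) with hq
  have hqv : ∀ v, inner ℝ (q + α • (u₀ - ud)) v
      = j' (T u₀ + y) (T v) + α * inner ℝ (u₀ - ud) v := fun v => by
    rw [inner_add_left, real_inner_smul_left, hq, InnerProductSpace.toDual_symm_apply]
    rfl
  rw [h]
  refine ⟨q + α • (u₀ - ud), fun v => ?_, fun u => ?_⟩
  · rw [hqv]
    have h1 : HasLineDerivAt ℝ (fun u => j (T u + y)) (j' (T u₀ + y) (T v)) u₀ v := by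
      have h2 := hj' (T u₀ + y) (T v)
      unfold HasLineDerivAt at h2 ⊢
      convert h2 using 3
      rw [map_add, map_smul]
      abel
    exact HasDerivAt.add h1 (hasLineDerivAt_sq_dist α ud u₀ v)
  · rw [hqv]
    have h1 := add_lineDeriv_le_of_convexOn hj (hj' (T u₀ + y) (T (u - u₀)))
    rw [show T u₀ + y + T (u - u₀) = T u + y by rw [map_sub]; abel] at h1
    -- Exact expansion of the square; added to the subgradient inequality for `j`, it leaves the
    -- full remainder `α / 2 * ‖u - u₀‖ ^ 2`.
    have h2 : ‖u - ud‖ ^ 2 = ‖u₀ - ud‖ ^ 2 + 2 * inner ℝ (u₀ - ud) (u - u₀) + ‖u - u₀‖ ^ 2 := by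
      rw [← norm_add_sq_real]
      congr 2
      abel
    simp only [h2]
    linarith

end Objective

/-! ### Strong duality and the bound on the gap -/

/-- The value of the pre-dual problem is at most `-J(u₀)`, if `u₀` solves the primal problem. -/
theorem predualObjective_le_of_isSolution (hΩ : Bornology.IsBounded (Ω : Set (Rd d)))
    {J : L2 Ω → ℝ} {c : ℝ} (hc : 0 < c) {u₀ p : L2 Ω} (hu₀ : IsSolution J (feasible Ω) u₀)
    (hp : ∀ v, HasLineDerivAt ℝ J (inner ℝ p v) u₀ v)
    (hJ : ∀ u, J u₀ + inner ℝ p (u - u₀) + c * ‖u - u₀‖ ^ 2 ≤ J u)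
    {Φ : H0div Ω} (hΦ : IsSolution (predualObjective J) (boundedFields Ω) Φ) (u : L2 Ω) :
    inner ℝ u Φ.div - J u + (eLpNorm Φ.field ∞ (leb Ω)).toReal ≤ -J u₀ := by
  have hfeas : feasible Ω = {u | ∀ w ∈ testDivergences Ω, inner ℝ u w ≤ 1} :=
    ext fun u => mem_feasible_iff hΩ u
  have hconv : Convex ℝ (feasible Ω) := by
    rw [hfeas]
    exact convex_polar id (fun _ => 1) _
  -- Test fields only come within `δ` of the bound, but `Φ` is optimal and does at least as well as
  -- each of them.
  refine le_of_forall_pos_le_add fun δ hδ => ?_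
  obtain ⟨s, hs, w, ⟨φ, hφ, rfl⟩, h⟩ := exists_dual_le hc hJ convex_testDivergences
    zero_mem_testDivergences
    (fun v hv => hu₀.lineDeriv_nonneg hconv ((mem_feasible_iff hΩ v).2 hv) (hp _)) hδ
  set Ψ : H0div Ω := (-s) • H0div.ofTest φ with hΨ
  have hΨd : Ψ.div = -(s • (H0div.ofTest φ).div) := neg_smul _ _
  have hΨn : eLpNorm Ψ.field ∞ (leb Ω) ≤ ENNReal.ofReal s := by
    rw [hΨ, eLpNorm_field_smul, eLpNorm_ofTest_field, abs_neg, abs_of_nonneg hs]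
    exact mul_le_of_le_one_right' hφ
  have hle : predualObjective J Φ ≤ predualObjective J Ψ :=
    hΦ.2 (hΨn.trans_lt ENNReal.ofReal_lt_top)
  have hΨle : predualObjective J Ψ ≤ ((-J u₀ + δ : ℝ) : EReal) := by
    have h1 : conjugate J Ψ.div ≤ ((-J u₀ + δ - s : ℝ) : EReal) :=
      iSup_le fun v => EReal.coe_le_coe_iff.2 (by rw [hΨd]; linarith [h v])
    have h2 : ((eLpNorm Ψ.field ∞ (leb Ω) : ℝ≥0∞) : EReal) ≤ ((s : ℝ) : EReal) := by
      refine (EReal.coe_ennreal_le_coe_ennreal_iff.2 hΨn).trans_eq ?_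
      rw [EReal.coe_ennreal_ofReal, max_eq_left hs]
    refine (add_le_add h1 h2).trans_eq ?_
    rw [← EReal.coe_add, sub_add_cancel]
  -- The supremum defining the conjugate is bounded below by its term at `u`.
  have hΦle : ((inner ℝ u Φ.div - J u + (eLpNorm Φ.field ∞ (leb Ω)).toReal : ℝ) : EReal)
      ≤ predualObjective J Φ := by
    rw [EReal.coe_add]
    refine add_le_add (le_iSup (fun v => ((inner ℝ v Φ.div - J v : ℝ) : EReal)) u) ?_
    rw [EReal.coe_ennreal_toReal hΦ.1.ne]
  exact EReal.coe_le_coe_iff.1 (hΦle.trans (hle.trans hΨle))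

/-- The gap between the minimal values of the original and the regularized problem is at most
`ε / (2 t) a[Φ, Φ]`, where `Φ` is a solution of the pre-dual problem and `t = ‖Φ‖_∞`. -/
theorem neg_inner_div_sub_norm_le {H : Type*} [NormedAddCommGroup H] [InnerProductSpace ℝ H]
    {ι : H →L[ℝ] H0div Ω} {a : H →L[ℝ] H →L[ℝ] ℝ} {ε : ℝ}
    (h_dense : unitBall ι ⊆ closure (testUnitBall ι))
    {u : L2 Ω} (hu : u ∈ regFeasible ι a ε) {Φ : H} (hΦ : ι Φ ∈ boundedFields Ω) :
    -inner ℝ u (ι Φ).div - (eLpNorm (ι Φ).field ∞ (leb Ω)).toReal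
      ≤ a Φ Φ / (2 * (eLpNorm (ι Φ).field ∞ (leb Ω)).toReal) * ε := by
  set t := (eLpNorm (ι Φ).field ∞ (leb Ω)).toReal with ht
  have htt : eLpNorm (ι Φ).field ∞ (leb Ω) = ENNReal.ofReal t := (ENNReal.ofReal_toReal hΦ.ne).symm
  have ht0 : 0 ≤ t := ENNReal.toReal_nonneg
  rcases ht0.eq_or_lt with h0 | h0
  · rw [← h0, ENNReal.ofReal_zero] at htt
    have h1 : (ι Φ).field = 0 := by
      rw [Lp.eq_zero_iff_ae_eq_zero]
      exact (eLpNorm_eq_zero_iff (Lp.aestronglyMeasurable _) (by simp)).1 htt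
    rw [div_eq_zero_of_field_eq_zero h1, ← h0]
    simp
  -- The normalized field, with the sign that turns the constraint into a bound on `-inner ℝ u (ι
  -- Φ).div`; it is in general only a limit of test fields.
  · have hb : (-t⁻¹) • Φ ∈ unitBall ι := by
      change eLpNorm (ι ((-t⁻¹) • Φ)).field ∞ (leb Ω) ≤ 1
      rw [map_smul, eLpNorm_field_smul, htt, ← ENNReal.ofReal_mul (abs_nonneg _), abs_neg,
        abs_of_pos (inv_pos.2 h0), inv_mul_cancel₀ h0.ne', ENNReal.ofReal_one]
    have h1 := inner_div_le_of_mem_regFeasible h_dense hu hb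
    have h2 : (ι ((-t⁻¹) • Φ)).div = (-t⁻¹) • (ι Φ).div := by rw [map_smul]; rfl
    rw [h2, real_inner_smul_right] at h1
    simp only [map_smul, smul_apply, smul_eq_mul] at h1
    have h3 := mul_le_mul_of_nonneg_left h1 h0.le
    have h4 : t * (-t⁻¹ * inner ℝ u (ι Φ).div) = -inner ℝ u (ι Φ).div := by field_simp
    have h5 : t * (1 + ε / 2 * (-t⁻¹ * (-t⁻¹ * a Φ Φ))) = t + a Φ Φ / (2 * t) * ε := by field_simp
    rw [h4, h5] at h3
    linarith

end TVControl

/-! ### The error estimate -/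

open TVControl
theorem corollary4p6 {d : ℕ} (hd : 1 ≤ d) (hd4 : d ≤ 4)
    (Ω : Opens (Rd d)) (hΩ : IsBoundedLipschitzDomain Ω)
    -- the data of the control problem
    (j : H10 Ω → ℝ) (hj_convex : ConvexOn ℝ univ j) (hj_lsc : LowerSemicontinuous j)
    (hj_bdd : BddBelow (range j)) (hj_smooth : IsLSmooth j)
    (α : ℝ) (hα : 0 < α) (ud : L2 Ω) (f : Hm1 Ω)
    -- the Hilbert space, a proper subspace of `H₀(div; Ω)` containing the test fields
    {H : Type*} [NormedAddCommGroup H] [InnerProductSpace ℝ H] [CompleteSpace H]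
    (ι : H →L[ℝ] H0div Ω) (hι_inj : Function.Injective ι)
    (hι_test : ∀ φ : 𝓓(Ω, Rd d), ∃ h : H, ι h = H0div.ofTest φ)
    (hι_proper : ¬ Function.Surjective ι)
    -- the symmetric, bounded and coercive bilinear form
    (a : H →L[ℝ] H →L[ℝ] ℝ) (ha_symm : ∀ h k, a h k = a k h) (ha_coercive : IsCoercive a)
    -- the density assumption
    (h_dense : unitBall ι ⊆ closure (testUnitBall ι))
    -- some solution of the pre-dual problem lies in the Hilbert space
    (h_predual : ∃ Φ : H,
      IsSolution (predualObjective (objective j α ud f)) (boundedFields Ω) (ι Φ)) :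
    (∃! u, IsSolution (objective j α ud f) (feasible Ω) u) ∧
    (∀ ε : ℝ, 0 < ε → ∃! u, IsSolution (objective j α ud f) (regFeasible ι a ε) u) ∧
    ∃ C : ℝ, 0 < C ∧ ∀ ε : ℝ, 0 < ε → ∀ uStar uε : L2 Ω,
      IsSolution (objective j α ud f) (feasible Ω) uStar →
      IsSolution (objective j α ud f) (regFeasible ι a ε) uε →
        0 ≤ objective j α ud f uStar - objective j α ud f uε ∧
        objective j α ud f uStar - objective j α ud f uε ≤ C * ε ∧
        ‖uStar - uε‖ ≤ C * √ε := by
  have hb := hΩ.bounded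
  set J := objective j α ud f with hJdef
  have hmid : ∀ u v, J (midpoint ℝ u v) ≤ (J u + J v) / 2 - α / 8 * ‖u - v‖ ^ 2 :=
    objective_midpoint_le hd hb hj_convex
  have hlsc : LowerSemicontinuous J := lowerSemicontinuous_objective hd hb hj_lsc
  have hbdd : BddBelow (range J) := bddBelow_range_objective hα.le hj_bdd
  have ha : ∀ h, 0 ≤ a h h := fun h => by
    obtain ⟨C, hC, hCa⟩ := ha_coercive
    exact le_trans (by positivity) (hCa h)
  have hfeas : feasible Ω = {u | ∀ w ∈ testDivergences Ω, inner ℝ u w ≤ 1} :=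
    ext fun u => mem_feasible_iff hb u
  have hreg : ∀ ε, regFeasible ι a ε
      = {u | ∀ h ∈ testUnitBall ι, inner ℝ u (ι h).div ≤ 1 + ε / 2 * a h h} := fun ε =>
    ext fun u => mem_regFeasible_iff u
  have hregconv : ∀ ε, Convex ℝ (regFeasible ι a ε) := fun ε => by
    rw [hreg]
    exact convex_polar _ _ _
  have hsub : ∀ ε : ℝ, 0 < ε → feasible Ω ⊆ regFeasible ι a ε := fun ε hε =>
    feasible_subset_regFeasible hb ha hε.le
  have hne : (feasible Ω).Nonempty := ⟨0, (mem_feasible_iff hb 0).2 fun w _ => by simp⟩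
  refine ⟨?_, fun ε hε => ?_, ?_⟩
  · refine existsUnique_isSolution_of_midpoint (by positivity) hmid hlsc hbdd ?_ ?_ hne
    · rw [hfeas]
      exact isClosed_polar id (fun _ => 1) _
    · rw [hfeas]
      exact convex_polar id (fun _ => 1) _
  · refine existsUnique_isSolution_of_midpoint (by positivity) hmid hlsc hbdd ?_ (hregconv ε)
      (hne.mono (hsub ε hε))
    rw [hreg]
    exact isClosed_polar _ _ _
  · obtain ⟨Φ, hΦ⟩ := h_predual
    -- For a vanishing field the denominator is `0`, so `c = 0` by the convention for division; this
    -- is the right constant, as the gap is then zero.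
    set c := a Φ Φ / (2 * (eLpNorm (ι Φ).field ∞ (leb Ω)).toReal) with hc
    have hc0 : 0 ≤ c := div_nonneg (ha Φ) (by positivity)
    have hC1 : c ≤ c + √(4 / α * c) + 1 := by linarith [Real.sqrt_nonneg (4 / α * c)]
    have hC2 : √(4 / α * c) ≤ c + √(4 / α * c) + 1 := by linarith
    -- One constant dominating both rates; the `1` makes it positive even if `c = 0`.
    refine ⟨c + √(4 / α * c) + 1, by positivity, fun ε hε uStar uε hS hR => ?_⟩
    have hmem := hsub ε hε hS.1
    have h1 : J uε ≤ J uStar := hR.2 hmem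
    have h2 : J uStar - J uε ≤ c * ε := by
      obtain ⟨p, hp, hpJ⟩ := exists_gradient_objective (α := α) (ud := ud) (f := f) hd hb hj_convex
        hj_smooth uStar
      have h3 := predualObjective_le_of_isSolution hb (half_pos hα) hS hp hpJ hΦ uε
      have h4 := neg_inner_div_sub_norm_le h_dense hR.1 hΦ.1
      linarith
    refine ⟨sub_nonneg.2 h1, h2.trans (mul_le_mul_of_nonneg_right hC1 hε.le), ?_⟩
    -- Growth is taken at `uε`, since `uStar` is feasible for its problem but not conversely in
    -- general. The modulus `2 * (α / 8)` accounts for the factor `4 / α`.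
    have h3 := hR.quadratic_growth hmid (hregconv ε) hmem
    have h4 : ‖uStar - uε‖ ^ 2 ≤ 4 / α * c * ε := by
      rw [div_mul_eq_mul_div, div_mul_eq_mul_div, le_div_iff₀ hα]
      linarith
    calc ‖uStar - uε‖ ≤ √(4 / α * c * ε) := Real.le_sqrt_of_sq_le h4
      _ = √(4 / α * c) * √ε := Real.sqrt_mul (by positivity) ε
      _ ≤ _ := mul_le_mul_of_nonneg_right hC2 (Real.sqrt_nonneg ε)
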